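/- **Setting.** Let $(G,T,\ell,u,w)$ be an instance of the Periodic Event Scheduling Problem: $G=(V,A)$ is a finite directed graph, $T\in\mathbb N$ with $T\ge 2$, $\ell,u\in\mathbb Z^A$ and $w\in\mathbb R^A$. Let $\mathcal C=\{\gamma\in\mathbb Z^A \mid \sum_{a\in\delta^+(i)}\gamma_a=\sum_{a\in\delta^-(i)}\gamma_a \text{ for all } i\in V\}$ be the cycle space of $G$. Let $\Gamma\in\{-1,0,1\}^{B\times A}$ be the cycle matrix of an integral cycle basis $B$ of $G$, i.e., its rows lie in $\mathcal C\cap\{-1,0,1\}^A$ and form a $\mathbb Z$-basis of $\mathcal C$. The cycle-based MIP formulation has the constraints $\Gamma x=Tz$, $\ell\le x\le u$, $z$ integer; its LP relaxation is $$\mathcal P=\{(x,z)\in\mathbb R^A\times\mathbb R^B \mid \Gamma x=Tz,\ \ell\le x\le u\}.$$ **Flip inequalities.** Let $[\cdot]_T$ denote the residue modulo $T$ in $[0,T)$. For $\gamma\in\mathcal C$ and $F\subseteq A$ set $\alpha=\alpha_{\gamma,F}=\big[-\sum_{a\in A\setminus F}\gamma_a\ell_a-\sum_{a\in F}\gamma_a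 u_a\big]_T$. The flip inequality of $(\gamma,F)$ is $$(T-\alpha)\sum_{a\notin F,\,\gamma_a>0}\gamma_a(x_a-\ell_a)+\alpha\sum_{a\notin F,\,\gamma_a<0}(-\gamma_a)(x_a-\ell_a)+\alpha\sum_{a\in F,\,\gamma_a>0}\gamma_a(u_a-x_a)+(T-\alpha)\sum_{a\in F,\,\gamma_a<0}(-\gamma_a)(u_a-x_a)\ \ge\ \alpha(T-\alpha).$$ It is called non-trivial if $\alpha_{\gamma,F}\ne0$. The flip polytope $\mathcal P_{\mathrm{flip}}$ is the set of all $(x,z)\in\mathcal P$ that satisfy the flip inequalities of all $\gamma\in\mathcal C$ and $F\subseteq A$. **Split inequalities.** Write $\mathcal P$ as $\{(x,z)\mid A_Cx+A_Iz\le b\}$ with the four row blocks $\Gamma x-Tz\le0$, $-\Gamma x+Tz\le0$, $x\le u$, $-x\le-\ell$. Let $\Lambda$ be the set of real vectors $\lambda$, indexed by the rows, such that $\lambda^\top A_C=0$, $\lambda^\top A_I$ is integral, $\lambda^\top b\notin\mathbb Z$, and the rows of $(A_C\ A_I)$ corresponding to the non-zero entries of $\lambda$ are linearly independent. With $\lambda_\pm=\max(\pm\lambda,0)$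 and $[\cdot]_1$ the fractional part, the split inequality of $\lambda\in\Lambda$ is $$\frac{\lambda_+^\top(b-A_Cx-A_Iz)}{[\lambda^\top b]_1}+\frac{\lambda_-^\top(b-A_Cx-A_Iz)}{1-[\lambda^\top b]_1}\ \ge\ 1.$$ The split closure is $\mathcal P_{\mathrm{split}}=\bigcap_{(\beta,\beta_0)\in\mathbb Z^B\times\mathbb Z}\operatorname{conv}\big(\{(x,z)\in\mathcal P\mid\beta^\top z\le\beta_0\}\cup\{(x,z)\in\mathcal P\mid\beta^\top z\ge\beta_0+1\}\big)$. Two inequalities $f\ge r$ and $g\ge s$ in $(x,z)$ are identified if there is a constant $c>0$ with $f-r=c\,(g-s)$ at all points of $\mathbb R^A\times\mathbb R^B$ with $\Gamma x=Tz$. **Theorem 3.1.** With this identification, every flip inequality with $\alpha_{\gamma,F}\ne0$ ($\gamma\in\mathcal C$, $F\subseteq A$) is the split inequality of some $\lambda\in\Lambda$, and for every $\lambda\in\Lambda$ the split inequality is a flip inequality of some $\gamma\in\mathcal C$ and $F\subseteq A$ with $\alpha_{\gamma,F}\neq0$. Moreover, $\mathcal P_{\mathrm{split}}=\mathcal P_{\mathrm{flip}}$.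 -/

import Mathlib

/-! ## Mixed-integer sets and their split closure -/

/-- A mixed-integer linear system `A_C x + A_I z ≤ b`, with rows indexed by `M`, continuous
variables indexed by `N` and integer variables indexed by `P`. -/
structure MISystem (M N P : Type*) where
  AC : Matrix M N ℝ
  AI : Matrix M P ℝ
  b : M → ℝ

namespace MISystem

variable {M N P : Type*} [Fintype M] [Fintype N] [Fintype P]

/-- The slack vector `b - A_C x - A_I z`. -/
def slack (S : MISystem M N P) (p : (N → ℝ) × (P → ℝ)) : M → ℝ :=
  S.b - S.AC.mulVec p.1 - S.AI.mulVec p.2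

/-- The polyhedron of the linear relaxation, `{(x, z) | A_C x + A_I z ≤ b}`. -/
def polyhedron (S : MISystem M N P) : Set ((N → ℝ) × (P → ℝ)) :=
  {p | S.AC.mulVec p.1 + S.AI.mulVec p.2 ≤ S.b}

/-- `P^(β, β₀)`: the convex hull of the part of the polyhedron that satisfies the split
disjunction `βᵀ z ≤ β₀ ∨ βᵀ z ≥ β₀ + 1`. -/
def splitHull (S : MISystem M N P) (β : P → ℤ) (β₀ : ℤ) : Set ((N → ℝ) × (P → ℝ)) :=
  convexHull ℝ
    ({p | p ∈ S.polyhedron ∧ ∑ j, (β j : ℝ) * p.2 j ≤ (β₀ : ℝ)} ∪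
      {p | p ∈ S.polyhedron ∧ (β₀ : ℝ) + 1 ≤ ∑ j, (β j : ℝ) * p.2 j})

/-- The split closure: the intersection of the hulls `P^(β, β₀)` over all splits. -/
def splitClosure (S : MISystem M N P) : Set ((N → ℝ) × (P → ℝ)) :=
  ⋂ (β : P → ℤ) (β₀ : ℤ), S.splitHull β β₀

/-- The set `Λ` of multiplier vectors that define split inequalities: `mᵀ A_C = 0`, `mᵀ A_I` is
integral, `mᵀ b` is not an integer, and the rows of `(A_C  A_I)` that belong to the non-zero
entries of `m` are linearly independent. -/
def splitMultipliers (S : MISystem M N P) : Set (M → ℝ) :=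
  {m | Matrix.vecMul m S.AC = 0 ∧
    (∀ j, ∃ k : ℤ, Matrix.vecMul m S.AI j = (k : ℝ)) ∧
    (∀ k : ℤ, dotProduct m S.b ≠ (k : ℝ)) ∧
    LinearIndependent ℝ
      (fun i : {i : M // m i ≠ 0} => (Matrix.fromCols S.AC S.AI) i.1)}

/-- The left-hand side of the split inequality of the multiplier `m`,
`m₊ᵀ (b - A_C x - A_I z) / [mᵀ b]₁ + m₋ᵀ (b - A_C x - A_I z) / (1 - [mᵀ b]₁) ≥ 1`,
where `[·]₁` is the fractional part. -/
noncomputable def splitLHS (S : MISystem M N P) (m : M → ℝ) (p : (N → ℝ) × (P → ℝ)) : ℝ :=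
  (∑ i, max (m i) 0 * S.slack p i) / Int.fract (dotProduct m S.b) +
    (∑ i, max (-(m i)) 0 * S.slack p i) / (1 - Int.fract (dotProduct m S.b))

end MISystem

/-- On the set `E`, the inequalities `lhs₁ ≥ rhs₁` and `lhs₂ ≥ rhs₂` are the same up to
multiplication by a positive constant. For the solution set `E` of a system of linear equations,
this is the usual identification of linear inequalities modulo the equations and scaling. -/
def SameInequalityOn {X : Type*} (E : Set X) (lhs₁ : X → ℝ) (rhs₁ : ℝ) (lhs₂ : X → ℝ)
    (rhs₂ : ℝ) : Prop :=
  ∃ c : ℝ, 0 < c ∧ ∀ p ∈ E, lhs₁ p - rhs₁ = c * (lhs₂ p - rhs₂)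

/-! ## Periodic event scheduling -/

/-- An instance of the Periodic Event Scheduling Problem on a directed graph with vertex set `V`
and arc set `A`, where the arc `a` leads from `src a` to `tgt a`. -/
structure PESPInstance (V A : Type*) where
  src : A → V
  tgt : A → V
  T : ℕ
  two_le_T : 2 ≤ T
  lower : A → ℤ
  upper : A → ℤ
  weight : A → ℝ

namespace PESPInstance

variable {V A B : Type*} [Fintype V] [DecidableEq V] [Fintype A] [DecidableEq A]
  [Fintype B] [DecidableEq B]

/-- The cycle space: the integral vectors on the arcs for which, at every vertex, the sum over
the outgoing arcs equals the sum over the incoming arcs. -/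
def cycleSpace (I : PESPInstance V A) : Submodule ℤ (A → ℤ) where
  carrier := {γ | ∀ i : V,
    ∑ a ∈ Finset.univ.filter (fun a => I.src a = i), γ a =
      ∑ a ∈ Finset.univ.filter (fun a => I.tgt a = i), γ a}
  zero_mem' := by intro i; simp
  add_mem' := by
    intro γ δ hγ hδ i
    simp only [Pi.add_apply, Finset.sum_add_distrib]
    rw [hγ i, hδ i]
  smul_mem' := by
    intro c γ hγ i
    simp only [Pi.smul_apply, smul_eq_mul, ← Finset.mul_sum]
    rw [hγ i]

/-- `Γ` is the cycle matrix of an integral cycle basis: its rows are oriented cycles (elements of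
the cycle space with entries in `{-1, 0, 1}`) that form a `ℤ`-basis of the cycle space. -/
structure IsCycleMatrix (I : PESPInstance V A) (Γ : Matrix B A ℤ) : Prop where
  entries : ∀ i a, Γ i a = -1 ∨ Γ i a = 0 ∨ Γ i a = 1
  linearIndependent : LinearIndependent ℤ (fun i : B => Γ i)
  span_eq : Submodule.span ℤ (Set.range (fun i : B => Γ i)) = I.cycleSpace

/-- The solution set of the equations `Γ x = T z`. -/
def equationSet (I : PESPInstance V A) (Γ : Matrix B A ℤ) : Set ((A → ℝ) × (B → ℝ)) :=
  {p | (Γ.map (Int.cast : ℤ → ℝ)).mulVec p.1 = (I.T : ℝ) • p.2}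

/-- The fractional periodic timetabling polytope `{(x, z) | Γ x = T z, ℓ ≤ x ≤ u}`. -/
def fracPolytope (I : PESPInstance V A) (Γ : Matrix B A ℤ) : Set ((A → ℝ) × (B → ℝ)) :=
  {p | p ∈ I.equationSet Γ ∧ ∀ a, (I.lower a : ℝ) ≤ p.1 a ∧ p.1 a ≤ (I.upper a : ℝ)}

/-- The cycle-based mixed-integer formulation in inequality form: the four row blocks are
`Γ x - T z ≤ 0`, `-Γ x + T z ≤ 0`, `x ≤ u` and `-x ≤ -ℓ`. -/
def cycleMIP (I : PESPInstance V A) (Γ : Matrix B A ℤ) : MISystem (B ⊕ B ⊕ A ⊕ A) A B where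
  AC := Matrix.fromRows (Γ.map (Int.cast : ℤ → ℝ))
    (Matrix.fromRows (-(Γ.map (Int.cast : ℤ → ℝ))) (Matrix.fromRows 1 (-1)))
  AI := Matrix.fromRows (-((I.T : ℝ) • (1 : Matrix B B ℝ)))
    (Matrix.fromRows ((I.T : ℝ) • (1 : Matrix B B ℝ)) (Matrix.fromRows 0 0))
  b := Sum.elim 0 (Sum.elim 0
    (Sum.elim (fun a => (I.upper a : ℝ)) (fun a => -(I.lower a : ℝ))))

/-- `α_{γ,F} = [-∑_{a ∉ F} γ_a ℓ_a - ∑_{a ∈ F} γ_a u_a]_T`, the residue modulo `T` in `[0, T)`. -/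
def flipAlpha (I : PESPInstance V A) (γ : A → ℤ) (F : Finset A) : ℤ :=
  (-(∑ a ∈ Fᶜ, γ a * I.lower a) - ∑ a ∈ F, γ a * I.upper a) % (I.T : ℤ)

/-- The left-hand side of the flip inequality of `(γ, F)`. -/
def flipLHS (I : PESPInstance V A) (γ : A → ℤ) (F : Finset A) (p : (A → ℝ) × (B → ℝ)) : ℝ :=
  ((I.T : ℝ) - I.flipAlpha γ F) *
      ∑ a ∈ Fᶜ.filter (fun a => 0 < γ a), (γ a : ℝ) * (p.1 a - I.lower a) +
    (I.flipAlpha γ F : ℝ) *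
      ∑ a ∈ Fᶜ.filter (fun a => γ a < 0), (-(γ a : ℝ)) * (p.1 a - I.lower a) +
    (I.flipAlpha γ F : ℝ) *
      ∑ a ∈ F.filter (fun a => 0 < γ a), (γ a : ℝ) * (I.upper a - p.1 a) +
    ((I.T : ℝ) - I.flipAlpha γ F) *
      ∑ a ∈ F.filter (fun a => γ a < 0), (-(γ a : ℝ)) * (I.upper a - p.1 a)

/-- The right-hand side `α_{γ,F} (T - α_{γ,F})` of the flip inequality of `(γ, F)`. -/
def flipRHS (I : PESPInstance V A) (γ : A → ℤ) (F : Finset A) : ℝ :=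
  (I.flipAlpha γ F : ℝ) * ((I.T : ℝ) - I.flipAlpha γ F)

/-- The flip polytope: the points of the fractional periodic timetabling polytope that satisfy
the flip inequalities of all `γ` in the cycle space and all arc sets `F`. -/
def flipPolytope (I : PESPInstance V A) (Γ : Matrix B A ℤ) : Set ((A → ℝ) × (B → ℝ)) :=
  {p | p ∈ I.fracPolytope Γ ∧
    ∀ γ ∈ I.cycleSpace, ∀ F : Finset A, I.flipRHS γ F ≤ I.flipLHS γ F p}

end PESPInstance

/-!
Fix `γ = kᵀ Γ` in the cycle space and an arc set `F`, and split the flip inequality as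
`(T - α) s + α t ≥ α (T - α)`. Here `s` (`flipPos`) and `t` (`flipNeg`) are nonnegative sums of
slacks of the bounds `ℓ ≤ x ≤ u`, and `s - t = γ x + c` (`flipPos_sub_flipNeg`) for an integer `c`
with residue `α` modulo `T`.

*Correspondence of the inequalities.* A multiplier in `Λ` has the form `(λ₁, λ₂, λ₃, λ₄)`, where
`T (λ₁ - λ₂) = k` is integral and `λ₃ - λ₄ = -γ / T` for `γ = kᵀ Γ`. Linear independence of the
supporting rows says that `λ₃` and `λ₄` have disjoint supports, so `λ₃ = -γ / T` on an arc set `F`,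
`λ₄ = γ / T` off `F`, and both vanish otherwise. The rows `Γ x = T z` have slack zero on the
equation set, so only `λ₃` and `λ₄` contribute to the split inequality; it reads
`s / α + t / (T - α) ≥ 1`, the flip inequality divided by `α (T - α)` (`sameInequalityOn_flip`).
Conversely, `(k / T, 0, λ₃, λ₄)` lies in `Λ` for every `γ = kᵀ Γ` and `F` with `α ≠ 0`.

*The closures.* On the polytope, `s - t = T (kᵀ z + q) + α` for an integer `q`. If
`kᵀ z ≥ -q`, then `s ≥ t + α`; if `kᵀ z ≤ -q - 1`, then `t ≥ s + T - α`. Either bound gives the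
flip inequality, which is therefore valid for a split hull (`splitClosure_subset_flipPolytope`).
For the reverse inclusion, let `(x, z)` be in the flip polytope with `βᵀ z = β₀ + f`, `0 < f < 1`,
and put `γ = βᵀ Γ`. The point is in the split hull as soon as some `d` with `γ d = T` keeps both
`x - f d` and `x + (1 - f) d` within the bounds. The maximum of `γ d` under these bounds is
`s / f + t / (1 - f)` for the set `F` that records which of the two bounds on `d a` is the
smaller one, and the flip inequality of `(γ, F)` makes it at least `T`
(`flipPolytope_subset_splitHull`).
-/

/-! ### Mixed-integer systems -/

namespace MISystem

variable {M N P : Type*}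

/-- Independence of the rows in the support of `m`, in terms of multiplier vectors on all rows. -/
theorem linearIndependent_support_iff [Fintype M] (S : MISystem M N P) (m : M → ℝ) :
    LinearIndependent ℝ (fun i : {i : M // m i ≠ 0} => (Matrix.fromCols S.AC S.AI) i.1) ↔
      ∀ g : M → ℝ, (∀ i, m i = 0 → g i = 0) → Matrix.vecMul g S.AC = 0 →
        Matrix.vecMul g S.AI = 0 → g = 0 := by
  classical
  have key : ∀ g : M → ℝ, (∀ i, m i = 0 → g i = 0) →
      ∑ i : {i : M // m i ≠ 0}, g i.1 • (Matrix.fromCols S.AC S.AI) i.1 =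
        Matrix.vecMul g (Matrix.fromCols S.AC S.AI) := by
    intro g hg
    rw [Matrix.vecMul_eq_sum]
    refine (Finset.sum_subtype (Finset.univ.filter fun i => m i ≠ 0) (by simp)
      (fun i => g i • (Matrix.fromCols S.AC S.AI) i)).symm.trans ?_
    refine Finset.sum_filter_of_ne fun i _ hi hmi => hi ?_
    rw [hg i hmi]
    exact zero_smul ℝ _
  rw [Fintype.linearIndependent_iff]
  constructor
  · intro h g hg hC hI
    have h0 := h (fun i => g i.1) (by rw [key g hg, Matrix.vecMul_fromCols, hC, hI]; ext (_ | _) <;> rfl)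
    funext i
    by_cases hi : m i = 0
    · exact hg i hi
    · exact h0 ⟨i, hi⟩
  · intro h g hg
    set G : M → ℝ := fun i => if hi : m i ≠ 0 then g ⟨i, hi⟩ else 0 with hG
    have hGg : ∀ i : {i : M // m i ≠ 0}, G i.1 = g i := fun i => by simp [hG, i.2]
    have hG0 : ∀ i, m i = 0 → G i = 0 := fun i hi => by simp [hG, hi]
    have hv : Matrix.vecMul G (Matrix.fromCols S.AC S.AI) = 0 := by
      rw [← key G hG0, ← hg]
      exact Finset.sum_congr rfl fun i _ => by rw [hGg]
    rw [Matrix.vecMul_fromCols] at hv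
    have := h G hG0 (funext fun j => congrFun hv (Sum.inl j)) (funext fun j => congrFun hv (Sum.inr j))
    intro i
    rw [← hGg, this]; rfl

variable [Fintype N] [Fintype P]

theorem convex_polyhedron (S : MISystem M N P) : Convex ℝ S.polyhedron := by
  intro p hp q hq a b ha hb hab i
  have h1 := mul_le_mul_of_nonneg_left (hp i) ha
  have h2 := mul_le_mul_of_nonneg_left (hq i) hb
  have h3 : S.b i = a * S.b i + b * S.b i := by rw [← add_mul, hab, one_mul]
  simp only [Prod.fst_add, Prod.snd_add, Prod.smul_fst, Prod.smul_snd, Matrix.mulVec_add,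
    Matrix.mulVec_smul, Pi.add_apply, Pi.smul_apply, smul_eq_mul] at h1 h2 ⊢
  linarith

theorem splitHull_subset_polyhedron (S : MISystem M N P) (β : P → ℤ) (β₀ : ℤ) :
    S.splitHull β β₀ ⊆ S.polyhedron :=
  convexHull_min (Set.union_subset (fun _ h => h.1) fun _ h => h.1) S.convex_polyhedron

end MISystem

theorem SameInequalityOn.symm {X : Type*} {E : Set X} {f g : X → ℝ} {r s : ℝ}
    (h : SameInequalityOn E f r g s) : SameInequalityOn E g s f r := by
  obtain ⟨c, hc, h⟩ := h
  refine ⟨c⁻¹, inv_pos.2 hc, fun p hp => ?_⟩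
  rw [h p hp, inv_mul_cancel_left₀ hc.ne']

namespace PESPInstance

/-! ### The two slack sums of a flip inequality -/

section Flip

variable {V A B : Type*} (I : PESPInstance V A)

theorem T_pos : (0 : ℝ) < I.T := by
  have := I.two_le_T
  positivity

theorem sum_filter_pos (γ : A → ℤ) (F : Finset A) (g : A → ℝ) :
    ∑ a ∈ F.filter (fun a => 0 < γ a), (γ a : ℝ) * g a = ∑ a ∈ F, max (γ a : ℝ) 0 * g a := by
  rw [Finset.sum_filter]
  refine Finset.sum_congr rfl fun a _ => ?_
  split_ifs with h
  · rw [max_eq_left (by exact_mod_cast h.le)]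
  · rw [max_eq_right (by exact_mod_cast not_lt.1 h), zero_mul]

theorem sum_filter_neg (γ : A → ℤ) (F : Finset A) (g : A → ℝ) :
    ∑ a ∈ F.filter (fun a => γ a < 0), (-(γ a : ℝ)) * g a =
      ∑ a ∈ F, max (-(γ a : ℝ)) 0 * g a := by
  simpa using sum_filter_pos (fun a => -γ a) F g

variable [Fintype A] [DecidableEq A]

/-- The sum of slacks that enters the flip inequality of `(γ, F)` with coefficient `T - α`, as one
sum over all arcs, with the positive and negative parts of `γ` written as maxima. -/
def flipPos (γ : A → ℤ) (F : Finset A) (x : A → ℝ) : ℝ :=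
  ∑ a, if a ∈ F then max (-(γ a : ℝ)) 0 * (I.upper a - x a)
    else max (γ a : ℝ) 0 * (x a - I.lower a)

/-- The sum of slacks that enters the flip inequality of `(γ, F)` with coefficient `α`. -/
def flipNeg (γ : A → ℤ) (F : Finset A) (x : A → ℝ) : ℝ :=
  ∑ a, if a ∈ F then max (γ a : ℝ) 0 * (I.upper a - x a)
    else max (-(γ a : ℝ)) 0 * (x a - I.lower a)

/-- The integer whose residue modulo `T` is `flipAlpha`. -/
def flipShift (γ : A → ℤ) (F : Finset A) : ℤ :=
  -(∑ a ∈ Fᶜ, γ a * I.lower a) - ∑ a ∈ F, γ a * I.upper a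

theorem sum_ite_mem_compl (F : Finset A) (f g : A → ℝ) :
    ∑ a, (if a ∈ F then f a else g a) = ∑ a ∈ Fᶜ, g a + ∑ a ∈ F, f a := by
  rw [← Finset.sum_compl_add_sum F]
  congr 1
  · exact Finset.sum_congr rfl fun a ha => if_neg (Finset.mem_compl.1 ha)
  · exact Finset.sum_congr rfl fun a ha => if_pos ha

theorem flipLHS_eq (γ : A → ℤ) (F : Finset A) (p : (A → ℝ) × (B → ℝ)) :
    I.flipLHS γ F p = ((I.T : ℝ) - I.flipAlpha γ F) * I.flipPos γ F p.1 +
      I.flipAlpha γ F * I.flipNeg γ F p.1 := by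
  rw [flipLHS, flipPos, flipNeg, sum_ite_mem_compl, sum_ite_mem_compl,
    sum_filter_pos _ _ (fun a => p.1 a - I.lower a),
    sum_filter_neg _ _ (fun a => p.1 a - I.lower a),
    sum_filter_pos _ _ (fun a => I.upper a - p.1 a),
    sum_filter_neg _ _ (fun a => I.upper a - p.1 a)]
  ring

theorem flipShift_cast (γ : A → ℤ) (F : Finset A) :
    (I.flipShift γ F : ℝ) =
      -∑ a, if a ∈ F then (γ a : ℝ) * I.upper a else (γ a : ℝ) * I.lower a := by
  rw [sum_ite_mem_compl, flipShift]
  push_cast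
  ring

/-- The difference of the two slack sums depends on `x` only through `γ x`. -/
theorem flipPos_sub_flipNeg (γ : A → ℤ) (F : Finset A) (x : A → ℝ) :
    I.flipPos γ F x - I.flipNeg γ F x = ∑ a, (γ a : ℝ) * x a + I.flipShift γ F := by
  rw [flipPos, flipNeg, flipShift_cast, ← sub_eq_add_neg, ← Finset.sum_sub_distrib,
    ← Finset.sum_sub_distrib]
  refine Finset.sum_congr rfl fun a _ => ?_
  have h : max (γ a : ℝ) 0 = max (-(γ a : ℝ)) 0 + γ a := by
    rcases le_total (γ a : ℝ) 0 with h | h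
    · rw [max_eq_right h, max_eq_left (by linarith)]; ring
    · rw [max_eq_left h, max_eq_right (by linarith)]; ring
  split_ifs <;> rw [h] <;> ring

theorem flipPos_nonneg (γ : A → ℤ) (F : Finset A) {x : A → ℝ}
    (hx : ∀ a, (I.lower a : ℝ) ≤ x a ∧ x a ≤ (I.upper a : ℝ)) : 0 ≤ I.flipPos γ F x := by
  refine Finset.sum_nonneg fun a _ => ?_
  have h1 := sub_nonneg.2 (hx a).1
  have h2 := sub_nonneg.2 (hx a).2
  split_ifs <;> positivity

theorem flipNeg_nonneg (γ : A → ℤ) (F : Finset A) {x : A → ℝ}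
    (hx : ∀ a, (I.lower a : ℝ) ≤ x a ∧ x a ≤ (I.upper a : ℝ)) : 0 ≤ I.flipNeg γ F x := by
  refine Finset.sum_nonneg fun a _ => ?_
  have h1 := sub_nonneg.2 (hx a).1
  have h2 := sub_nonneg.2 (hx a).2
  split_ifs <;> positivity

theorem flipAlpha_nonneg (γ : A → ℤ) (F : Finset A) : (0 : ℝ) ≤ I.flipAlpha γ F := by
  have h : (0 : ℤ) < I.T := by exact_mod_cast I.T_pos
  exact_mod_cast Int.emod_nonneg _ h.ne'

theorem flipAlpha_lt (γ : A → ℤ) (F : Finset A) : (I.flipAlpha γ F : ℝ) < I.T := by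
  have h : (0 : ℤ) < I.T := by exact_mod_cast I.T_pos
  exact_mod_cast Int.emod_lt_of_pos _ h

theorem exists_flipShift_eq (γ : A → ℤ) (F : Finset A) :
    ∃ q : ℤ, (I.flipShift γ F : ℝ) = I.T * q + I.flipAlpha γ F :=
  ⟨I.flipShift γ F / I.T, by exact_mod_cast (Int.mul_ediv_add_emod (I.flipShift γ F) I.T).symm⟩

theorem fract_flipShift_div (γ : A → ℤ) (F : Finset A) :
    Int.fract ((I.flipShift γ F : ℝ) / I.T) = I.flipAlpha γ F / I.T :=
  Int.fract_div_intCast_eq_div_intCast_mod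

end Flip

/-! ### The cycle-based formulation -/

section Cycles

variable {V A B : Type*} [Fintype B] (I : PESPInstance V A) {Γ : Matrix B A ℤ}

theorem cast_vecMul (k : B → ℤ) (a : A) :
    ((Matrix.vecMul k Γ a : ℤ) : ℝ) = ∑ i, (k i : ℝ) * (Γ i a : ℝ) := by
  simp [Matrix.vecMul, dotProduct]

variable [Fintype A]

theorem IsCycleMatrix.mem_cycleSpace_iff [DecidableEq V] {I : PESPInstance V A}
    (hΓ : I.IsCycleMatrix Γ) (γ : A → ℤ) : γ ∈ I.cycleSpace ↔ ∃ k : B → ℤ, Matrix.vecMul k Γ = γ := by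
  rw [← hΓ.span_eq, Submodule.mem_span_range_iff_exists_fun]
  simp only [Matrix.vecMul_eq_sum]

/-- If `Γ x = T z`, then `(kᵀ Γ) x = T kᵀ z`. -/
theorem sum_cycle_mul {p : (A → ℝ) × (B → ℝ)} (hp : p ∈ I.equationSet Γ) (k : B → ℤ) :
    ∑ a, ((Matrix.vecMul k Γ a : ℤ) : ℝ) * p.1 a = I.T * ∑ i, (k i : ℝ) * p.2 i := by
  have h : ∀ i, ∑ a, (Γ i a : ℝ) * p.1 a = I.T * p.2 i := fun i => congrFun hp i
  simp only [cast_vecMul, Finset.sum_mul, Finset.mul_sum]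
  rw [Finset.sum_comm]
  refine Finset.sum_congr rfl fun i _ => ?_
  rw [mul_left_comm, ← h i, Finset.mul_sum]
  exact Finset.sum_congr rfl fun a _ => mul_assoc _ _ _

variable [DecidableEq A] [DecidableEq B]

theorem polyhedron_cycleMIP : (I.cycleMIP Γ).polyhedron = I.fracPolytope Γ := by
  ext p
  simp only [MISystem.polyhedron, cycleMIP, fracPolytope, equationSet, Set.mem_ofPred_eq,
    Pi.le_def, Sum.forall, Matrix.fromRows_mulVec, Pi.add_apply, Sum.elim_inl, Sum.elim_inr,
    Matrix.neg_mulVec, Matrix.smul_mulVec, Matrix.one_mulVec, Matrix.zero_mulVec, Pi.neg_apply,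
    Pi.zero_apply, Pi.smul_apply, smul_eq_mul, add_zero, neg_le_neg_iff, funext_iff]
  constructor
  · rintro ⟨h1, h2, h3, h4⟩
    exact ⟨fun i => by linarith [h1 i, h2 i], fun a => ⟨h4 a, h3 a⟩⟩
  · rintro ⟨h1, h2⟩
    exact ⟨fun i => by linarith [h1 i], fun i => by linarith [h1 i], fun a => (h2 a).2,
      fun a => (h2 a).1⟩

theorem vecMul_AC (m : B ⊕ B ⊕ A ⊕ A → ℝ) (a : A) :
    Matrix.vecMul m (I.cycleMIP Γ).AC a =
      ∑ i, (m (.inl i) - m (.inr (.inl i))) * (Γ i a : ℝ) +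
        (m (.inr (.inr (.inl a))) - m (.inr (.inr (.inr a)))) := by
  simp [cycleMIP, Matrix.vecMul, dotProduct, Fintype.sum_sum_type, Matrix.one_apply, sub_mul]
  ring

theorem vecMul_AI (m : B ⊕ B ⊕ A ⊕ A → ℝ) (i : B) :
    Matrix.vecMul m (I.cycleMIP Γ).AI i = -(I.T * (m (.inl i) - m (.inr (.inl i)))) := by
  simp [cycleMIP, Matrix.vecMul, dotProduct, Fintype.sum_sum_type, Matrix.one_apply]
  ring

/-! ### Split inequalities and flip inequalities -/

section

variable {m : B ⊕ B ⊕ A ⊕ A → ℝ} {γ : A → ℤ} {F : Finset A}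

theorem dotProduct_b
    (hu : ∀ a, m (.inr (.inr (.inl a))) = if a ∈ F then -(γ a : ℝ) / I.T else 0)
    (hl : ∀ a, m (.inr (.inr (.inr a))) = if a ∈ F then 0 else (γ a : ℝ) / I.T) :
    dotProduct m (I.cycleMIP Γ).b = (I.flipShift γ F : ℝ) / I.T := by
  rw [flipShift_cast, ← Finset.sum_neg_distrib, Finset.sum_div]
  simp only [cycleMIP, dotProduct, Fintype.sum_sum_type, Sum.elim_inl, Sum.elim_inr, Pi.zero_apply,
    mul_zero, Finset.sum_const_zero, zero_add, hu, hl, ← Finset.sum_add_distrib]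
  refine Finset.sum_congr rfl fun a _ => ?_
  split_ifs <;> ring

/-- On the equation set the rows `Γ x = T z` have no slack, so the entries of `m` on these rows are
irrelevant. -/
theorem sum_max_mul_slack
    (hu : ∀ a, m (.inr (.inr (.inl a))) = if a ∈ F then -(γ a : ℝ) / I.T else 0)
    (hl : ∀ a, m (.inr (.inr (.inr a))) = if a ∈ F then 0 else (γ a : ℝ) / I.T)
    {p : (A → ℝ) × (B → ℝ)} (hp : p ∈ I.equationSet Γ) :
    ∑ i, max (m i) 0 * (I.cycleMIP Γ).slack p i = I.flipPos γ F p.1 / I.T ∧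
      ∑ i, max (-(m i)) 0 * (I.cycleMIP Γ).slack p i = I.flipNeg γ F p.1 / I.T := by
  have hT := I.T_pos
  have h : ∀ i, (Γ.map (Int.cast : ℤ → ℝ)).mulVec p.1 i = I.T * p.2 i := fun i => congrFun hp i
  have h1 : ∀ i, (I.cycleMIP Γ).slack p (.inl i) = 0 := fun i => by
    simp [MISystem.slack, cycleMIP, Matrix.fromRows_mulVec, Matrix.neg_mulVec,
      Matrix.smul_mulVec, h]
  have h2 : ∀ i, (I.cycleMIP Γ).slack p (.inr (.inl i)) = 0 := fun i => by
    simp [MISystem.slack, cycleMIP, Matrix.fromRows_mulVec, Matrix.neg_mulVec,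
      Matrix.smul_mulVec, h]
  have h3 : ∀ a, (I.cycleMIP Γ).slack p (.inr (.inr (.inl a))) = I.upper a - p.1 a := fun i => by
    simp [MISystem.slack, cycleMIP, Matrix.fromRows_mulVec]
  have h4 : ∀ a, (I.cycleMIP Γ).slack p (.inr (.inr (.inr a))) = p.1 a - I.lower a := fun i => by
    simp [MISystem.slack, cycleMIP, Matrix.fromRows_mulVec, Matrix.neg_mulVec]
    ring
  have hmax : ∀ r : ℝ, max (r / I.T) 0 = max r 0 / I.T := fun r => by
    rw [← max_div_div_right hT.le, zero_div]
  simp only [Fintype.sum_sum_type, h1, h2, h3, h4, mul_zero, Finset.sum_const_zero, zero_add, hu,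
    hl, ← Finset.sum_add_distrib, flipPos, flipNeg, Finset.sum_div]
  constructor <;> refine Finset.sum_congr rfl fun a _ => ?_ <;> split_ifs <;>
    simp only [← neg_div, neg_neg, hmax, neg_zero, max_self] <;> ring

/-- If `m` is `-γ / T` on the upper bounds of `F`, `γ / T` on the lower bounds off `F`, and zero on
the other bounds, then its split inequality times `α (T - α)` is the flip inequality. -/
theorem sameInequalityOn_flip
    (hu : ∀ a, m (.inr (.inr (.inl a))) = if a ∈ F then -(γ a : ℝ) / I.T else 0)
    (hl : ∀ a, m (.inr (.inr (.inr a))) = if a ∈ F then 0 else (γ a : ℝ) / I.T)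
    (hα : I.flipAlpha γ F ≠ 0) :
    SameInequalityOn (I.equationSet Γ) (I.flipLHS γ F) (I.flipRHS γ F)
      ((I.cycleMIP Γ).splitLHS m) 1 := by
  have hT := I.T_pos
  have h0 : (0 : ℝ) < I.flipAlpha γ F :=
    (I.flipAlpha_nonneg γ F).lt_of_ne' (by exact_mod_cast hα)
  have h1 : (0 : ℝ) < I.T - I.flipAlpha γ F := sub_pos.2 (I.flipAlpha_lt γ F)
  refine ⟨I.flipAlpha γ F * (I.T - I.flipAlpha γ F), mul_pos h0 h1, fun p hp => ?_⟩
  obtain ⟨hs, ht⟩ := I.sum_max_mul_slack hu hl hp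
  rw [MISystem.splitLHS, hs, ht, I.dotProduct_b hu hl, fract_flipShift_div, flipLHS_eq, flipRHS,
    one_sub_div hT.ne']
  field_simp

theorem forall_dotProduct_b_ne_iff
    (hu : ∀ a, m (.inr (.inr (.inl a))) = if a ∈ F then -(γ a : ℝ) / I.T else 0)
    (hl : ∀ a, m (.inr (.inr (.inr a))) = if a ∈ F then 0 else (γ a : ℝ) / I.T) :
    (∀ k : ℤ, dotProduct m (I.cycleMIP Γ).b ≠ (k : ℝ)) ↔ I.flipAlpha γ F ≠ 0 := by
  have hT := I.T_pos
  rw [I.dotProduct_b hu hl, ← not_exists, not_iff_not]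
  have h : (∃ k : ℤ, (I.flipShift γ F : ℝ) / I.T = k) ↔
      Int.fract ((I.flipShift γ F : ℝ) / I.T) = 0 := by
    rw [Int.fract_eq_zero_iff]
    exact ⟨fun ⟨k, hk⟩ => ⟨k, hk.symm⟩, fun ⟨k, hk⟩ => ⟨k, hk.symm⟩⟩
  rw [h, fract_flipShift_div, div_eq_zero_iff, or_iff_left hT.ne', Int.cast_eq_zero]

end

variable [DecidableEq V]

theorem exists_splitMultiplier (hΓ : I.IsCycleMatrix Γ) {γ : A → ℤ} (hγ : γ ∈ I.cycleSpace)
    {F : Finset A} (hα : I.flipAlpha γ F ≠ 0) :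
    ∃ m ∈ (I.cycleMIP Γ).splitMultipliers,
      SameInequalityOn (I.equationSet Γ) (I.flipLHS γ F) (I.flipRHS γ F)
        ((I.cycleMIP Γ).splitLHS m) 1 := by
  have hT := I.T_pos
  obtain ⟨k, rfl⟩ := (hΓ.mem_cycleSpace_iff γ).1 hγ
  set γ := Matrix.vecMul k Γ with hγk
  let m : B ⊕ B ⊕ A ⊕ A → ℝ := Sum.elim (fun i => (k i : ℝ) / I.T) (Sum.elim (fun _ => 0)
    (Sum.elim (fun a => if a ∈ F then -(γ a : ℝ) / I.T else 0)
      (fun a => if a ∈ F then 0 else (γ a : ℝ) / I.T)))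
  have hu : ∀ a, m (.inr (.inr (.inl a))) = if a ∈ F then -(γ a : ℝ) / I.T else 0 := fun _ => rfl
  have hl : ∀ a, m (.inr (.inr (.inr a))) = if a ∈ F then 0 else (γ a : ℝ) / I.T := fun _ => rfl
  refine ⟨m, ⟨?_, ?_, (I.forall_dotProduct_b_ne_iff hu hl).2 hα, ?_⟩,
    I.sameInequalityOn_flip hu hl hα⟩
  · funext a
    rw [vecMul_AC, hu, hl]
    have : ∑ i, (m (.inl i) - m (.inr (.inl i))) * (Γ i a : ℝ) = (γ a : ℝ) / I.T := by
      rw [hγk, cast_vecMul, Finset.sum_div]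
      refine Finset.sum_congr rfl fun i _ => ?_
      simp only [m, Sum.elim_inl, Sum.elim_inr]
      ring
    rw [this, Pi.zero_apply]
    split_ifs <;> ring
  · intro i
    refine ⟨-k i, ?_⟩
    rw [vecMul_AI]
    simp only [m, Sum.elim_inl, Sum.elim_inr]
    push_cast
    field_simp
    ring
  · rw [MISystem.linearIndependent_support_iff]
    intro g hg hC hI
    have h2 : ∀ i, g (.inr (.inl i)) = 0 := fun i => hg _ rfl
    have h1 : ∀ i, g (.inl i) = 0 := fun i => by
      have := congrFun hI i
      rw [vecMul_AI, h2, sub_zero, Pi.zero_apply, neg_eq_zero] at this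
      exact (mul_eq_zero.1 this).resolve_left hT.ne'
    have h34 : ∀ a, g (.inr (.inr (.inl a))) = g (.inr (.inr (.inr a))) := fun a => by
      have := congrFun hC a
      rw [vecMul_AC] at this
      simpa [h1, h2, sub_eq_zero] using this
    have h3 : ∀ a, g (.inr (.inr (.inl a))) = 0 := fun a => by
      by_cases ha : a ∈ F
      · rw [h34]; exact hg _ (by rw [hl, if_pos ha])
      · exact hg _ (by rw [hu, if_neg ha])
    funext i
    rcases i with i | i | a | a
    exacts [h1 i, h2 i, h3 a, (h34 a).symm.trans (h3 a)]

theorem exists_flip (hΓ : I.IsCycleMatrix Γ) {m : B ⊕ B ⊕ A ⊕ A → ℝ}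
    (hm : m ∈ (I.cycleMIP Γ).splitMultipliers) :
    ∃ γ ∈ I.cycleSpace, ∃ F : Finset A, I.flipAlpha γ F ≠ 0 ∧
      SameInequalityOn (I.equationSet Γ) ((I.cycleMIP Γ).splitLHS m) 1
        (I.flipLHS γ F) (I.flipRHS γ F) := by
  classical
  have hT := I.T_pos
  obtain ⟨hC, hI, hb, hli⟩ := hm
  rw [MISystem.linearIndependent_support_iff] at hli
  choose n hn using hI
  set γ := Matrix.vecMul (-n) Γ with hγ
  have hk : ∀ i, m (.inl i) - m (.inr (.inl i)) = ((-n) i : ℤ) / I.T := fun i => by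
    rw [eq_div_iff hT.ne', Pi.neg_apply, Int.cast_neg, ← hn, vecMul_AI]
    ring
  have hsub : ∀ a, m (.inr (.inr (.inl a))) - m (.inr (.inr (.inr a))) = -(γ a : ℝ) / I.T := by
    intro a
    have h := congrFun hC a
    rw [vecMul_AC, Pi.zero_apply] at h
    have h' : ∑ i, (m (.inl i) - m (.inr (.inl i))) * (Γ i a : ℝ) = (γ a : ℝ) / I.T := by
      rw [hγ, cast_vecMul, Finset.sum_div]
      refine Finset.sum_congr rfl fun i _ => ?_
      rw [hk]
      ring
    rw [neg_div, ← h']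
    linarith
  have hdisj : ∀ a, m (.inr (.inr (.inl a))) ≠ 0 → m (.inr (.inr (.inr a))) = 0 := by
    intro a h3
    by_contra h4
    -- the rows `x a ≤ u a` and `-x a ≤ -ℓ a` add up to zero
    have h := hli (Sum.elim 0 (Sum.elim 0 (Sum.elim (Pi.single a (1 : ℝ)) (Pi.single a (1 : ℝ))))) ?_ ?_ ?_
    · have := congrFun h (.inr (.inr (.inl a)))
      simp at this
    · rintro (i | i | c | c) hc
      · rfl
      · rfl
      · exact Pi.single_eq_of_ne (by rintro rfl; exact h3 hc) _
      · exact Pi.single_eq_of_ne (by rintro rfl; exact h4 hc) _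
    · funext c
      rw [vecMul_AC]
      simp
    · funext i
      rw [vecMul_AI]
      simp
  let F : Finset A := Finset.univ.filter fun a => m (.inr (.inr (.inl a))) ≠ 0
  have hu : ∀ a, m (.inr (.inr (.inl a))) = if a ∈ F then -(γ a : ℝ) / I.T else 0 := by
    intro a
    by_cases ha : m (.inr (.inr (.inl a))) = 0
    · simp [F, ha]
    · simp only [F, Finset.mem_filter, Finset.mem_univ, true_and, ne_eq, ha, not_false_eq_true,
        if_true]
      rw [← hsub, hdisj a ha, sub_zero]
  have hl : ∀ a, m (.inr (.inr (.inr a))) = if a ∈ F then 0 else (γ a : ℝ) / I.T := by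
    intro a
    by_cases ha : m (.inr (.inr (.inl a))) = 0
    · have := hsub a
      rw [ha, zero_sub, neg_div, neg_inj] at this
      simp [F, ha, this]
    · simp [F, ha, hdisj a ha]
  have hα := (I.forall_dotProduct_b_ne_iff hu hl).1 hb
  exact ⟨γ, (hΓ.mem_cycleSpace_iff γ).2 ⟨_, rfl⟩, F, hα, (I.sameInequalityOn_flip hu hl hα).symm⟩

/-! ### The split closure -/

theorem splitClosure_subset_flipPolytope (hΓ : I.IsCycleMatrix Γ) :
    (I.cycleMIP Γ).splitClosure ⊆ I.flipPolytope Γ := by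
  intro p hp
  have hp' : ∀ β β₀, p ∈ (I.cycleMIP Γ).splitHull β β₀ := fun β β₀ =>
    Set.mem_iInter.1 (Set.mem_iInter.1 hp β) β₀
  have hP := MISystem.splitHull_subset_polyhedron _ _ _ (hp' 0 0)
  rw [polyhedron_cycleMIP] at hP
  refine ⟨hP, ?_⟩
  intro γ hγ F
  obtain ⟨k, rfl⟩ := (hΓ.mem_cycleSpace_iff γ).1 hγ
  set γ := Matrix.vecMul k Γ with hγk
  obtain ⟨q, hq⟩ := I.exists_flipShift_eq γ F
  have hT := I.T_pos
  have hα0 := I.flipAlpha_nonneg γ F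
  have hα1 := (I.flipAlpha_lt γ F).le
  -- both slack sums are affine in `x`
  have hconv : Convex ℝ {p : (A → ℝ) × (B → ℝ) | I.flipRHS γ F ≤ I.flipLHS γ F p} := by
    intro y hy z hz a b ha hb hab
    have hpos : I.flipPos γ F (a • y + b • z).1 =
        a * I.flipPos γ F y.1 + b * I.flipPos γ F z.1 := by
      simp only [flipPos, Finset.mul_sum, ← Finset.sum_add_distrib]
      refine Finset.sum_congr rfl fun c _ => ?_
      obtain rfl : b = 1 - a := by linarith
      simp only [Prod.fst_add, Prod.smul_fst, Pi.add_apply, Pi.smul_apply, smul_eq_mul]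
      split_ifs <;> ring
    have hneg : I.flipNeg γ F (a • y + b • z).1 =
        a * I.flipNeg γ F y.1 + b * I.flipNeg γ F z.1 := by
      simp only [flipNeg, Finset.mul_sum, ← Finset.sum_add_distrib]
      refine Finset.sum_congr rfl fun c _ => ?_
      obtain rfl : b = 1 - a := by linarith
      simp only [Prod.fst_add, Prod.smul_fst, Pi.add_apply, Pi.smul_apply, smul_eq_mul]
      split_ifs <;> ring
    rw [Set.mem_ofPred_eq, flipLHS_eq] at hy hz ⊢
    rw [hpos, hneg]
    have h1 := mul_le_mul_of_nonneg_left hy ha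
    have h2 := mul_le_mul_of_nonneg_left hz hb
    have h3 : I.flipRHS γ F = a * I.flipRHS γ F + b * I.flipRHS γ F := by
      rw [← add_mul, hab, one_mul]
    linarith
  -- `s - t = T (kᵀ z + q) + α`, so the split at `β₀ = -q - 1` separates the two cases in which
  -- `s ≥ t + α` and `t ≥ s + T - α`
  refine convexHull_min (Set.union_subset ?_ ?_) hconv (hp' k (-q - 1)) <;>
  · rintro y ⟨hy, hky⟩
    rw [polyhedron_cycleMIP] at hy
    have hs := I.flipPos_nonneg γ F hy.2
    have ht := I.flipNeg_nonneg γ F hy.2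
    have hst := I.flipPos_sub_flipNeg γ F y.1
    rw [hq, hγk, I.sum_cycle_mul hy.1, ← hγk] at hst
    rw [Set.mem_ofPred_eq, flipLHS_eq, flipRHS]
    push_cast at hky
    have hky' := mul_le_mul_of_nonneg_left hky hT.le
    nlinarith

theorem flipPolytope_subset_splitHull (hΓ : I.IsCycleMatrix Γ) (β : B → ℤ) (β₀ : ℤ) :
    I.flipPolytope Γ ⊆ (I.cycleMIP Γ).splitHull β β₀ := by
  classical
  rintro p ⟨hp, hflip⟩
  have hT := I.T_pos
  by_cases hle : ∑ j, (β j : ℝ) * p.2 j ≤ β₀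
  · exact subset_convexHull ℝ _ (Or.inl ⟨by rwa [polyhedron_cycleMIP], hle⟩)
  by_cases hge : (β₀ : ℝ) + 1 ≤ ∑ j, (β j : ℝ) * p.2 j
  · exact subset_convexHull ℝ _ (Or.inr ⟨by rwa [polyhedron_cycleMIP], hge⟩)
  obtain ⟨f, hf⟩ : ∃ f : ℝ, ∑ j, (β j : ℝ) * p.2 j = β₀ + f := ⟨_, (add_sub_cancel _ _).symm⟩
  have hf0 : 0 < f := by linarith
  have hf1 : 0 < 1 - f := by linarith
  set γ := Matrix.vecMul β Γ with hγ
  obtain ⟨x, z⟩ := p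
  obtain ⟨hE, hx⟩ := hp
  dsimp only at hx hf
  -- such a `d` writes `(x, z)` as a convex combination of a point with `βᵀ z = β₀` and one with
  -- `βᵀ z = β₀ + 1`
  suffices hd : ∃ d : A → ℝ, ∑ a, (γ a : ℝ) * d a = I.T ∧
      ∀ a, ((I.lower a : ℝ) ≤ x a - f * d a ∧ x a - f * d a ≤ I.upper a) ∧
        ((I.lower a : ℝ) ≤ x a + (1 - f) * d a ∧ x a + (1 - f) * d a ≤ I.upper a) by
    obtain ⟨d, hdT, hd⟩ := hd
    set e : B → ℝ := (I.T : ℝ)⁻¹ • (Γ.map (Int.cast : ℤ → ℝ)).mulVec d with he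
    have hde : (d, e) ∈ I.equationSet Γ := by
      simp [equationSet, he, smul_smul, hT.ne']
    have hEr : ∀ r : ℝ, (x + r • d, z + r • e) ∈ I.equationSet Γ := fun r => by
      have h1 : (Γ.map (Int.cast : ℤ → ℝ)).mulVec x = (I.T : ℝ) • z := hE
      have h2 : (Γ.map (Int.cast : ℤ → ℝ)).mulVec d = (I.T : ℝ) • e := hde
      change (Γ.map (Int.cast : ℤ → ℝ)).mulVec (x + r • d) = (I.T : ℝ) • (z + r • e)
      rw [Matrix.mulVec_add, Matrix.mulVec_smul, h1, h2, smul_add, smul_comm r]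
    have hβe : ∑ j, (β j : ℝ) * e j = 1 := by
      have := I.sum_cycle_mul hde β
      rw [← hγ, hdT] at this
      exact (mul_left_cancel₀ hT.ne' (by rw [mul_one]; exact this)).symm
    have hβr : ∀ r : ℝ, ∑ j, (β j : ℝ) * (z + r • e) j = β₀ + f + r := fun r => by
      simp only [Pi.add_apply, Pi.smul_apply, smul_eq_mul, mul_add, Finset.sum_add_distrib, hf]
      simp only [mul_left_comm _ r, ← Finset.mul_sum, hβe, mul_one]
    have hmem1 : (x + (-f) • d, z + (-f) • e) ∈ (I.cycleMIP Γ).polyhedron := by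
      rw [polyhedron_cycleMIP]
      refine ⟨hEr _, fun a => ?_⟩
      have := (hd a).1
      simpa [sub_eq_add_neg] using this
    have hmem2 : (x + (1 - f) • d, z + (1 - f) • e) ∈ (I.cycleMIP Γ).polyhedron := by
      rw [polyhedron_cycleMIP]
      exact ⟨hEr _, fun a => (hd a).2⟩
    have hc : ((x, z) : (A → ℝ) × (B → ℝ)) =
        (1 - f) • (x + (-f) • d, z + (-f) • e) + f • (x + (1 - f) • d, z + (1 - f) • e) := by
      ext j <;> simp <;> ring
    have hconv : Convex ℝ ((I.cycleMIP Γ).splitHull β β₀) := convex_convexHull ℝ _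
    rw [hc]
    refine hconv (subset_convexHull ℝ _ (Or.inl ⟨hmem1, ?_⟩))
      (subset_convexHull ℝ _ (Or.inr ⟨hmem2, ?_⟩)) hf1.le hf0.le (by ring)
    · rw [hβr]; linarith
    · rw [hβr]; linarith
  -- `D` maximizes `γ d` over all `d` that keep `x - f d` and `x + (1 - f) d` within the bounds;
  -- `F` records the arcs on which the upper bound is the binding one
  let F : Finset A := Finset.univ.filter fun a =>
    if 0 ≤ γ a then f * (I.upper a - x a) ≤ (1 - f) * (x a - I.lower a)
    else (1 - f) * (I.upper a - x a) ≤ f * (x a - I.lower a)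
  let D : A → ℝ := fun a => if 0 ≤ γ a
    then (if a ∈ F then (I.upper a - x a) / (1 - f) else (x a - I.lower a) / f)
    else -(if a ∈ F then (I.upper a - x a) / f else (x a - I.lower a) / (1 - f))
  have hγD : ∑ a, (γ a : ℝ) * D a = I.flipPos γ F x / f + I.flipNeg γ F x / (1 - f) := by
    rw [flipPos, flipNeg, Finset.sum_div, Finset.sum_div, ← Finset.sum_add_distrib]
    refine Finset.sum_congr rfl fun a _ => ?_
    by_cases ha : 0 ≤ γ a
    · have ha' : (0 : ℝ) ≤ γ a := by exact_mod_cast ha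
      simp only [D, ha, if_true, max_eq_left ha', max_eq_right (neg_nonpos.2 ha')]
      split_ifs <;> ring
    · have ha' : (γ a : ℝ) ≤ 0 := by exact_mod_cast (not_le.1 ha).le
      simp only [D, ha, if_false, max_eq_right ha', max_eq_left (neg_nonneg.2 ha')]
      split_ifs <;> ring
  have hDb : ∀ a, ((I.lower a : ℝ) ≤ x a - f * D a ∧ x a - f * D a ≤ I.upper a) ∧
        ((I.lower a : ℝ) ≤ x a + (1 - f) * D a ∧ x a + (1 - f) * D a ≤ I.upper a) := by
    intro a
    have h1 := sub_nonneg.2 (hx a).1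
    have h2 := sub_nonneg.2 (hx a).2
    have key : ∀ {g g' U L : ℝ}, 0 < g' → g * U ≤ g' * L → g * (U / g') ≤ L := by
      intro g g' U L hg' h
      rwa [← mul_div_assoc, div_le_iff₀' hg']
    have h1f := mul_div_cancel₀ (x a - I.lower a) hf0.ne'
    have h2f := mul_div_cancel₀ (I.upper a - x a) hf0.ne'
    have h1g := mul_div_cancel₀ (x a - I.lower a) hf1.ne'
    have h2g := mul_div_cancel₀ (I.upper a - x a) hf1.ne'
    have e1 := div_nonneg h1 hf0.le
    have e2 := div_nonneg h2 hf0.le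
    have e3 := div_nonneg h1 hf1.le
    have e4 := div_nonneg h2 hf1.le
    by_cases ha : 0 ≤ γ a
    · by_cases haF : a ∈ F
      · have hm : f * (I.upper a - x a) ≤ (1 - f) * (x a - I.lower a) := by
          simpa [F, ha] using haF
        have hk := key hf1 hm
        simp only [D, ha, haF, if_true]
        have := mul_nonneg hf0.le e4
        refine ⟨⟨?_, ?_⟩, ?_, ?_⟩ <;> linarith
      · have hm : (1 - f) * (x a - I.lower a) ≤ f * (I.upper a - x a) := by
          have : ¬ f * (I.upper a - x a) ≤ (1 - f) * (x a - I.lower a) := by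
            simpa [F, ha] using haF
          exact (not_le.1 this).le
        have hk := key hf0 hm
        simp only [D, ha, haF, if_true, if_false]
        have := mul_nonneg hf1.le e1
        refine ⟨⟨?_, ?_⟩, ?_, ?_⟩ <;> linarith
    · by_cases haF : a ∈ F
      · have hm : (1 - f) * (I.upper a - x a) ≤ f * (x a - I.lower a) := by
          simpa [F, ha] using haF
        have hk := key hf0 hm
        simp only [D, ha, haF, if_true, if_false, mul_neg]
        have := mul_nonneg hf1.le e2
        refine ⟨⟨?_, ?_⟩, ?_, ?_⟩ <;> linarith
      · have hm : f * (x a - I.lower a) ≤ (1 - f) * (I.upper a - x a) := by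
          have : ¬ (1 - f) * (I.upper a - x a) ≤ f * (x a - I.lower a) := by
            simpa [F, ha] using haF
          exact (not_le.1 this).le
        have hk := key hf1 hm
        simp only [D, ha, haF, if_false, mul_neg]
        have := mul_nonneg hf0.le e3
        refine ⟨⟨?_, ?_⟩, ?_, ?_⟩ <;> linarith
  have hDT : (I.T : ℝ) ≤ ∑ a, (γ a : ℝ) * D a := by
    rw [hγD]
    have hs := I.flipPos_nonneg γ F hx
    have ht := I.flipNeg_nonneg γ F hx
    have hineq := hflip γ ((hΓ.mem_cycleSpace_iff γ).2 ⟨β, rfl⟩) F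
    have hst := I.flipPos_sub_flipNeg γ F x
    obtain ⟨q, hq⟩ := I.exists_flipShift_eq γ F
    have hα0 := I.flipAlpha_nonneg γ F
    have hα1 := I.flipAlpha_lt γ F
    have hsum := I.sum_cycle_mul hE β
    dsimp only at hsum
    rw [← hγ, hf] at hsum
    rw [hsum, hq] at hst
    rw [flipLHS_eq, flipRHS] at hineq
    dsimp only at hineq
    generalize I.flipPos γ F x = s at *
    generalize I.flipNeg γ F x = t at *
    generalize (I.flipAlpha γ F : ℝ) = α at *
    obtain ⟨n, hn⟩ : ∃ n : ℤ, n = β₀ + q := ⟨_, rfl⟩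
    have hn' : (n : ℝ) = β₀ + q := by rw [hn]; push_cast; rfl
    have hst' : s - t = I.T * (n + f) + α := by rw [hst, hn']; ring
    have hsf := div_nonneg hs hf0.le
    have htf := div_nonneg ht hf1.le
    -- `t ≥ (1 - f) T` for `n ≤ -2` and `s ≥ f T` for `n ≥ 0`; only `n = -1` needs the flip
    -- inequality, which gives `t ≥ (1 - f) (T - α)` and then `s ≥ f α`
    rcases lt_trichotomy n (-1) with h | h | h
    · have h' : (n : ℝ) ≤ -2 := by exact_mod_cast (by omega : n ≤ -2)
      have := mul_le_mul_of_nonneg_left h' hT.le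
      have : (I.T : ℝ) ≤ t / (1 - f) := by
        rw [le_div_iff₀ hf1]
        linarith
      linarith
    · rw [h] at hst'
      push_cast at hst'
      have ht' : (I.T - α) * (1 - f) ≤ t := by
        have hs' : s = t + α - I.T * (1 - f) := by linarith
        rw [hs'] at hineq
        refine le_of_mul_le_mul_left ?_ hT
        linarith
      have h1 : α ≤ s / f := by
        rw [le_div_iff₀ hf0]
        linarith
      have h2 : I.T - α ≤ t / (1 - f) := by
        rwa [le_div_iff₀ hf1]
      linarith
    · have h' : (0 : ℝ) ≤ n := by exact_mod_cast (by omega : 0 ≤ n)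
      have := mul_nonneg hT.le h'
      have : (I.T : ℝ) ≤ s / f := by
        rw [le_div_iff₀ hf0]
        linarith
      linarith
  -- the bounds are convex conditions that hold for `d = 0`, so `D` may be scaled down
  set W := ∑ a, (γ a : ℝ) * D a with hW
  have hWpos : 0 < W := hT.trans_le hDT
  have hc0 : 0 ≤ I.T / W := div_nonneg hT.le hWpos.le
  have hc1 : 0 ≤ 1 - I.T / W := sub_nonneg.2 ((div_le_one hWpos).2 hDT)
  refine ⟨fun a => I.T / W * D a, ?_, fun a => ?_⟩
  · simp only [mul_left_comm _ (I.T / W), ← Finset.mul_sum, ← hW]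
    exact div_mul_cancel₀ _ hWpos.ne'
  · obtain ⟨⟨h1, h2⟩, h3, h4⟩ := hDb a
    obtain ⟨h5, h6⟩ := hx a
    generalize I.T / W = c at *
    have e1 := mul_le_mul_of_nonneg_left h1 hc0
    have e2 := mul_le_mul_of_nonneg_left h2 hc0
    have e3 := mul_le_mul_of_nonneg_left h3 hc0
    have e4 := mul_le_mul_of_nonneg_left h4 hc0
    have e5 := mul_le_mul_of_nonneg_left h5 hc1
    have e6 := mul_le_mul_of_nonneg_left h6 hc1
    refine ⟨⟨?_, ?_⟩, ?_, ?_⟩ <;> linarith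

theorem splitClosure_eq_flipPolytope (hΓ : I.IsCycleMatrix Γ) :
    (I.cycleMIP Γ).splitClosure = I.flipPolytope Γ :=
  (I.splitClosure_subset_flipPolytope hΓ).antisymm <| Set.subset_iInter fun β =>
    Set.subset_iInter fun β₀ => I.flipPolytope_subset_splitHull hΓ β β₀

end Cycles

end PESPInstance

theorem theorem3p1 {V A B : Type*} [Fintype V] [DecidableEq V] [Fintype A] [DecidableEq A]
    [Fintype B] [DecidableEq B] (I : PESPInstance V A) (Γ : Matrix B A ℤ)
    (hΓ : I.IsCycleMatrix Γ) :
    (∀ γ ∈ I.cycleSpace, ∀ F : Finset A, I.flipAlpha γ F ≠ 0 →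
      ∃ m ∈ (I.cycleMIP Γ).splitMultipliers,
        SameInequalityOn (I.equationSet Γ) (I.flipLHS γ F) (I.flipRHS γ F)
          ((I.cycleMIP Γ).splitLHS m) 1) ∧
    (∀ m ∈ (I.cycleMIP Γ).splitMultipliers,
      ∃ γ ∈ I.cycleSpace, ∃ F : Finset A, I.flipAlpha γ F ≠ 0 ∧
        SameInequalityOn (I.equationSet Γ) ((I.cycleMIP Γ).splitLHS m) 1
          (I.flipLHS γ F) (I.flipRHS γ F)) ∧
    (I.cycleMIP Γ).splitClosure = I.flipPolytope Γ :=
  ⟨fun _ hγ _ hα => I.exists_splitMultiplier hΓ hγ hα, fun _ hm => I.exists_flip hΓ hm,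
    I.splitClosure_eq_flipPolytope hΓ⟩
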